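/- Let $(X_t)_{t\in\mathbb Z}$ be a time series of $\mathbb R^d$-valued random vectors on a probability space, let $F_t$ be the distribution function of $X_t$ and $F=F_1$, and let $\theta$ be an $\mathbb R^p$-valued functional of $d$-dimensional distribution functions. Suppose that the influence function $$\mathcal{IF}(x,F,\theta)=\lim_{\varepsilon\searrow 0}\frac{\theta((1-\varepsilon)F+\varepsilon\delta_x)-\theta(F)}{\varepsilon},\qquad \delta_x(z)=I\{x\le z\}\ \text{(componentwise)},$$ exists for all $x\in\mathbb R^d$. Let $T\ge 0$ be a constant. For $1\le i\le j$ put $\hat\theta_i^j=\theta(\hat F_i^j)$, where $\hat F_i^j(z)=\frac1{j-i+1}\sum_{t=i}^jI\{X_t\le z\}$, and put $\hat\theta_i^j=0$ if $i>j$. Define $$\tilde{\mathbb U}(\ell,z,u)=(u-z)(z-\ell)\big(\hat\theta_{\ell+1}^z-\hat\theta_{z+1}^u\big),\qquad R_{i,j}=\hat\theta_i^j-\theta(F)-\frac1{j-i+1}\sum_{t=i}^j\mathcal{IF}(X_t,F,\theta).$$ Weak convergence in a space $\ell^\infty(D,\mathbb R^p)$ of bounded functions with the supremum norm is understood in the sense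 of Hoffmann-Jørgensen: the limit is Borel measurable, and outer expectations of bounded continuous functions converge. Assume: 1. (Invariance principle) $(X_t)_{t\in\mathbb Z}$ is strictly stationary, $\mathcal{IF}(\cdot,F,\theta)$ is measurable and square integrable with respect to $F$ with $\mathbb E[\mathcal{IF}(X_1,F,\theta)]=0$, the series $\Sigma_F=\sum_{t\in\mathbb Z}\mathrm{Cov}\big(\mathcal{IF}(X_0,F,\theta),\mathcal{IF}(X_t,F,\theta)\big)$ converges (in the sense of its partial sums over $|t|\le N$), and, as $m\to\infty$, $$\Big\{\frac1{\sqrt m}\sum_{t=1}^{\lfloor ms\rfloor}\mathcal{IF}(X_t,F,\theta)\Big\}_{s\in[0,T+1]}\ \Longrightarrow\ \big\{\Sigma_F^{1/2}W(s)\big\}_{s\in[0,T+1]}$$ weakly in $\ell^\infty([0,T+1],\mathbb R^p)$, where $W$ is a standard $p$-dimensional Brownian motion and $\Sigma_F^{1/2}$ is the positive semidefinite square root. 2. (Remainders) As $n\to\infty$, $$\max_{1\le i\le j\le n}(j-i+1)\,|R_{i,j}|=o_{\mathbb P}(n^{1/2}).$$ Then, under the null hypothesis $H_0:\theta(F_1)=\theta(F_2)=\theta(F_3)=\cdots$,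 as $m\to\infty$, $$\Big\{m^{-3/2}\,\tilde{\mathbb U}(\lfloor mr\rfloor,\lfloor ms\rfloor,\lfloor mt\rfloor)\Big\}_{(r,s,t)\in\Delta_3}\ \Longrightarrow\ \Sigma_F^{1/2}\big\{B(s,t)+B(r,s)-B(r,t)\big\}_{(r,s,t)\in\Delta_3}$$ weakly in $\ell^\infty(\Delta_3,\mathbb R^p)$, where $\Delta_3=\{(r,s,t)\in[0,T+1]^3: r\le s\le t\}$ and $B(s,t)=tW(s)-sW(t)$. -/

import Mathlib

open MeasureTheory ProbabilityTheory Filter Topology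
open scoped ENNReal NNReal BoundedContinuousFunction

noncomputable section

namespace SeqMonitor

/-! ### Weak convergence in the space of bounded functions -/

/-- The space `ℓ^∞(D, E)` of bounded functions `D → E` with the supremum norm. -/
abbrev BddFun (D E : Type*) [NormedAddCommGroup E] : Type _ := lp (fun _ : D => E) ∞

instance instMeasurableSpaceBddFun (D E : Type*) [NormedAddCommGroup E] :
    MeasurableSpace (BddFun D E) := borel _

instance instBorelSpaceBddFun (D E : Type*) [NormedAddCommGroup E] :
    BorelSpace (BddFun D E) := ⟨rfl⟩

open Classical in
/-- A bounded path, viewed as a point of `ℓ^∞(D, E)` (an unbounded path is sent to `0`). -/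
def toBddFun {D E : Type*} [NormedAddCommGroup E] (g : D → E) : BddFun D E :=
  if h : Memℓp g ∞ then ⟨g, h⟩ else 0

/-- The outer expectation `E^* g = inf {E U : U ≥ g, U measurable and integrable}` of a bounded
function `g` that need not be measurable. -/
def outerExpectation {Ω : Type*} [MeasurableSpace Ω] (P : Measure Ω) (g : Ω → ℝ) : ℝ :=
  sInf {a : ℝ | ∃ U : Ω → ℝ, Measurable U ∧ Integrable U P ∧ (∀ ω, g ω ≤ U ω) ∧ a = ∫ ω, U ω ∂P}

/-- Weak convergence (in the sense of Hoffmann-Jørgensen) in `ℓ^∞(D, E)` of the processes `X m`,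
as `m → ∞`, to the process `Z`: all these processes have bounded paths almost surely, the limit is
a Borel random element of `ℓ^∞(D, E)`, and `E^* f(X m) → E f(Z)` for every bounded continuous
`f : ℓ^∞(D, E) → ℝ`. For Borel measurable `X m` this is the usual weak convergence of laws. -/
structure WeakConvBddFun {D E : Type*} [NormedAddCommGroup E]
    {Ω : Type*} [MeasurableSpace Ω] (P : Measure Ω)
    {Ω' : Type*} [MeasurableSpace Ω'] (Q : Measure Ω')
    (X : ℕ → Ω → D → E) (Z : Ω' → D → E) : Prop where
  bounded : ∀ m, ∀ᵐ ω ∂P, Memℓp (X m ω) ∞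
  bounded_limit : ∀ᵐ ω ∂Q, Memℓp (Z ω) ∞
  aemeasurable_limit : AEMeasurable (fun ω => toBddFun (Z ω)) Q
  tendsto : ∀ f : BddFun D E →ᵇ ℝ,
    Tendsto (fun m => outerExpectation P (fun ω => f (toBddFun (X m ω)))) atTop
      (𝓝 (∫ ω, f (toBddFun (Z ω)) ∂Q))

/-! ### Brownian motion -/

/-- Standard `p`-dimensional Brownian motion: the coordinates are independent standard real
Brownian motions. -/
structure IsStdBrownian {p : ℕ} {Ω' : Type*} [MeasurableSpace Ω']
    (W : ℝ≥0 → Ω' → EuclideanSpace ℝ (Fin p)) (Q : Measure Ω') : Prop where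
  coord : ∀ a : Fin p, IsBrownianReal (fun s ω => W s ω a) Q
  indep : iIndepFun (fun (a : Fin p) (ω : Ω') (s : ℝ≥0) => W s ω a) Q

/-- `B(s,t) = t W(s) - s W(t)`. -/
def bridge {p : ℕ} {Ω' : Type*} (W : ℝ≥0 → Ω' → EuclideanSpace ℝ (Fin p))
    (s t : ℝ) (ω : Ω') : EuclideanSpace ℝ (Fin p) :=
  t • W s.toNNReal ω - s • W t.toNNReal ω

/-- The pyramid `Δ₃ = {(r,s,t) ∈ [0,T+1]^3 : r ≤ s ≤ t}`. -/
def Delta3 (T : ℝ) : Set (ℝ × ℝ × ℝ) :=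
  {q | 0 ≤ q.1 ∧ q.1 ≤ q.2.1 ∧ q.2.1 ≤ q.2.2 ∧ q.2.2 ≤ T + 1}

/-! ### Distribution functions, functionals and influence functions -/

/-- The distribution function `z ↦ P(Y ≤ z)` (componentwise inequality) of a random vector. -/
def distFun {d : ℕ} {Ω : Type*} [MeasurableSpace Ω] (P : Measure Ω) (Y : Ω → Fin d → ℝ) :
    (Fin d → ℝ) → ℝ :=
  fun z => P.real {ω | Y ω ≤ z}

open Classical in
/-- The distribution function `z ↦ 1{x ≤ z}` of the Dirac measure at `x`. -/
def diracDistFun {d : ℕ} (x : Fin d → ℝ) : (Fin d → ℝ) → ℝ :=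
  fun z => if x ≤ z then 1 else 0

/-- The difference quotient `(θ((1-ε)F + ε δ_x) - θ(F)) / ε`. -/
def influenceQuotient {d p : ℕ} (θ : ((Fin d → ℝ) → ℝ) → EuclideanSpace ℝ (Fin p))
    (F : (Fin d → ℝ) → ℝ) (x : Fin d → ℝ) (ε : ℝ) : EuclideanSpace ℝ (Fin p) :=
  ε⁻¹ • (θ ((1 - ε) • F + ε • diracDistFun x) - θ F)

/-- The influence function of `θ` at `F` exists (at every point). -/
def InfluenceExists {d p : ℕ} (θ : ((Fin d → ℝ) → ℝ) → EuclideanSpace ℝ (Fin p))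
    (F : (Fin d → ℝ) → ℝ) : Prop :=
  ∀ x, ∃ y, Tendsto (influenceQuotient θ F x) (𝓝[>] 0) (𝓝 y)

/-- The influence function `IF(x, F, θ)`, the limit of the difference quotients as `ε ↘ 0`. -/
def influence {d p : ℕ} (θ : ((Fin d → ℝ) → ℝ) → EuclideanSpace ℝ (Fin p))
    (F : (Fin d → ℝ) → ℝ) (x : Fin d → ℝ) : EuclideanSpace ℝ (Fin p) :=
  limUnder (𝓝[>] 0) (influenceQuotient θ F x)

/-! ### Time series, estimators and the monitoring process -/

/-- Strict stationarity of a two-sided series: all shifts have the same law on `(ℝ^d)^ℤ`. -/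
def StrictlyStationary {d : ℕ} {Ω : Type*} [MeasurableSpace Ω] (P : Measure Ω)
    (X : ℤ → Ω → Fin d → ℝ) : Prop :=
  ∀ h : ℤ, IdentDistrib (fun ω t => X (t + h) ω) (fun ω t => X t ω) P P

/-- The null hypothesis `θ(F_1) = θ(F_2) = θ(F_3) = …`, with `F_t` the distribution function
of `X_t`. -/
def NullHypothesis {d p : ℕ} {Ω : Type*} [MeasurableSpace Ω] (P : Measure Ω)
    (X : ℤ → Ω → Fin d → ℝ) (θ : ((Fin d → ℝ) → ℝ) → EuclideanSpace ℝ (Fin p)) : Prop :=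
  ∀ t : ℤ, 1 ≤ t → θ (distFun P (X t)) = θ (distFun P (X 1))

/-- The empirical distribution function of `X_i, …, X_j`. -/
def empDistFun {d : ℕ} {Ω : Type*} (X : ℤ → Ω → Fin d → ℝ) (i j : ℕ) (ω : Ω) :
    (Fin d → ℝ) → ℝ :=
  fun z => ((j : ℝ) - i + 1)⁻¹ * ∑ t ∈ Finset.Icc i j, diracDistFun (X t ω) z

/-- The estimator `θ(F̂_i^j)` based on `X_i, …, X_j`, with the convention that it is `0`
if `i > j`. -/
def estimator {d p : ℕ} {Ω : Type*} (X : ℤ → Ω → Fin d → ℝ)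
    (θ : ((Fin d → ℝ) → ℝ) → EuclideanSpace ℝ (Fin p)) (i j : ℕ) (ω : Ω) :
    EuclideanSpace ℝ (Fin p) :=
  if i ≤ j then θ (empDistFun X i j ω) else 0

/-- `Ũ(ℓ,z,u) = (u - z)(z - ℓ)(θ̂_{ℓ+1}^z - θ̂_{z+1}^u)`. -/
def UTilde {d p : ℕ} {Ω : Type*} (X : ℤ → Ω → Fin d → ℝ)
    (θ : ((Fin d → ℝ) → ℝ) → EuclideanSpace ℝ (Fin p)) (l z u : ℕ) (ω : Ω) :
    EuclideanSpace ℝ (Fin p) :=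
  (((u : ℝ) - z) * ((z : ℝ) - l)) • (estimator X θ (l + 1) z ω - estimator X θ (z + 1) u ω)

/-- The remainder `R_{i,j} = θ̂_i^j - θ(F) - (j-i+1)⁻¹ ∑_{t=i}^j IF(X_t, F, θ)`, with `F` the
distribution function of `X_1`. -/
def remainder {d p : ℕ} {Ω : Type*} [MeasurableSpace Ω] (P : Measure Ω)
    (X : ℤ → Ω → Fin d → ℝ) (θ : ((Fin d → ℝ) → ℝ) → EuclideanSpace ℝ (Fin p)) (i j : ℕ) (ω : Ω) :
    EuclideanSpace ℝ (Fin p) :=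
  estimator X θ i j ω - θ (distFun P (X 1)) -
    ((j : ℝ) - i + 1)⁻¹ • ∑ t ∈ Finset.Icc i j, influence θ (distFun P (X 1)) (X t ω)

/-- `max_{1 ≤ i ≤ j ≤ n} (j-i+1) |R_{i,j}|` (equal to `0` if `n = 0`). -/
def maxRemainder {d p : ℕ} {Ω : Type*} [MeasurableSpace Ω] (P : Measure Ω)
    (X : ℤ → Ω → Fin d → ℝ) (θ : ((Fin d → ℝ) → ℝ) → EuclideanSpace ℝ (Fin p)) (n : ℕ) (ω : Ω) :
    ℝ≥0 :=
  (Finset.Icc 1 n).sup fun j => (Finset.Icc 1 j).sup fun i =>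
    ((j - i + 1 : ℕ) : ℝ≥0) * ‖remainder P X θ i j ω‖₊

/-- The covariance of the `a`-th coordinate of `IF(X_0, F, θ)` and the `b`-th coordinate
of `IF(X_t, F, θ)`. -/
def lagCov {d p : ℕ} {Ω : Type*} [MeasurableSpace Ω] (P : Measure Ω)
    (X : ℤ → Ω → Fin d → ℝ) (θ : ((Fin d → ℝ) → ℝ) → EuclideanSpace ℝ (Fin p))
    (a b : Fin p) (t : ℤ) : ℝ :=
  cov[fun ω => influence θ (distFun P (X 1)) (X 0 ω) a,
    fun ω => influence θ (distFun P (X 1)) (X t ω) b; P]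

/-- The long-run variance `Σ_F = ∑_{t ∈ ℤ} Cov(IF(X_0, F, θ), IF(X_t, F, θ))`, the limit of the
partial sums over `-N ≤ t ≤ N`. -/
def longRunVar {d p : ℕ} {Ω : Type*} [MeasurableSpace Ω] (P : Measure Ω)
    (X : ℤ → Ω → Fin d → ℝ) (θ : ((Fin d → ℝ) → ℝ) → EuclideanSpace ℝ (Fin p)) :
    Matrix (Fin p) (Fin p) ℝ :=
  Matrix.of fun a b => ∑'[SummationFilter.symmetricIcc ℤ] t : ℤ, lagCov P X θ a b t

open scoped MatrixOrder in
/-- The positive semidefinite square root `Σ_F^{1/2}`, acting on `ℝ^p`. -/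
def sqrtLongRunVar {d p : ℕ} {Ω : Type*} [MeasurableSpace Ω] (P : Measure Ω)
    (X : ℤ → Ω → Fin d → ℝ) (θ : ((Fin d → ℝ) → ℝ) → EuclideanSpace ℝ (Fin p)) :
    EuclideanSpace ℝ (Fin p) →ₗ[ℝ] EuclideanSpace ℝ (Fin p) :=
  Matrix.toEuclideanLin (CFC.sqrt (longRunVar P X θ))

/-- Stationarity and the invariance principle for the partial sums of the influence function, with
`F` the distribution function of `X_1` and `W` the Brownian motion in the limit. -/
structure InvariancePrinciple {d p : ℕ} {Ω Ω' : Type*} [MeasurableSpace Ω] [MeasurableSpace Ω']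
    (P : Measure Ω) (Q : Measure Ω') (X : ℤ → Ω → Fin d → ℝ)
    (θ : ((Fin d → ℝ) → ℝ) → EuclideanSpace ℝ (Fin p)) (T : ℝ)
    (W : ℝ≥0 → Ω' → EuclideanSpace ℝ (Fin p)) : Prop where
  stationary : StrictlyStationary P X
  /-- The influence function is measurable and square integrable with respect to `F`, so that
  its mean and its covariances exist. -/
  memLp : MemLp (influence θ (distFun P (X 1))) 2 (P.map (X 1))
  mean_zero : ∫ ω, influence θ (distFun P (X 1)) (X 1 ω) ∂P = 0
  summable : ∀ a b, Summable (lagCov P X θ a b) (SummationFilter.symmetricIcc ℤ)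
  weakConv : WeakConvBddFun P Q
    (fun (m : ℕ) ω (s : Set.Icc (0 : ℝ) (T + 1)) =>
      (√(m : ℝ))⁻¹ • ∑ t ∈ Finset.Icc 1 ⌊(m : ℝ) * s⌋₊, influence θ (distFun P (X 1)) (X t ω))
    (fun ω (s : Set.Icc (0 : ℝ) (T + 1)) => sqrtLongRunVar P X θ (W (s : ℝ).toNNReal ω))

/-- `max_{1 ≤ i ≤ j ≤ n} (j-i+1) |R_{i,j}| = o_P(n^{1/2})`. -/
def RemainderNegligible {d p : ℕ} {Ω : Type*} [MeasurableSpace Ω] (P : Measure Ω)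
    (X : ℤ → Ω → Fin d → ℝ) (θ : ((Fin d → ℝ) → ℝ) → EuclideanSpace ℝ (Fin p)) : Prop :=
  TendstoInMeasure P (fun (n : ℕ) ω => (maxRemainder P X θ n ω : ℝ) / √(n : ℝ)) atTop (fun _ => 0)

end SeqMonitor

end

noncomputable section

namespace SeqMonitor

/-! ### Outer expectations -/

section OuterExpectation

variable {Ω : Type*} [MeasurableSpace Ω] {P : Measure Ω} [IsProbabilityMeasure P]

/-! The rescaled process is, up to negligible errors, a continuous image of the partial sum process
of the influence function. Replacing each estimator by its influence expansion, the two copies of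
`θ(F)` cancel because they carry the common weight `(u - z)(z - l)`. What remains is the linear map
`contrast` applied to the partial sums, plus a rounding error and a remainder (`UTilde_eq`,
`norm_monitorPath_sub_contrast_le`). The rounding error is at most `4/m` times the sup norm of the
partial sum path, which vanishes since a weakly convergent sequence is bounded in outer probability
(`tendsto_outerExpectation_norm_div`); the remainder vanishes by assumption. `contrast` is bounded
and linear, hence continuous in sup norm, and applied to the limit path it gives the stated
combination of bridges. Continuous mapping and Slutsky's lemma then conclude. The paths need not be
measurable, so Slutsky is proved for outer expectations, which are only subadditive: each test
function is majorized by its Lipschitz sup-convolutions. -/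

lemma outerExpectation_le_integral {g U : Ω → ℝ} {c : ℝ} (hc : ∀ ω, c ≤ g ω) (hU : Measurable U)
    (hUi : Integrable U P) (h : ∀ ω, g ω ≤ U ω) : outerExpectation P g ≤ ∫ ω, U ω ∂P := by
  -- The lower bound `c` is needed because the real `sInf` of a set unbounded below is `0`.
  refine csInf_le ⟨c, ?_⟩ ⟨U, hU, hUi, h, rfl⟩
  rintro a ⟨V, -, hVi, hV, rfl⟩
  have := integral_mono (integrable_const c) hVi fun ω => (hc ω).trans (hV ω)
  simpa using this

lemma le_outerExpectation {g : Ω → ℝ} {a C : ℝ} (hC : ∀ ω, g ω ≤ C)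
    (h : ∀ U : Ω → ℝ, Measurable U → Integrable U P → (∀ ω, g ω ≤ U ω) → a ≤ ∫ ω, U ω ∂P) :
    a ≤ outerExpectation P g := by
  refine le_csInf ⟨_, fun _ => C, measurable_const, integrable_const C, hC, rfl⟩ ?_
  rintro b ⟨U, hU, hUi, hgU, rfl⟩
  exact h U hU hUi hgU

lemma outerExpectation_mono {g h : Ω → ℝ} {c C : ℝ} (hc : ∀ ω, c ≤ g ω) (hC : ∀ ω, h ω ≤ C)
    (hgh : ∀ ω, g ω ≤ h ω) : outerExpectation P g ≤ outerExpectation P h :=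
  le_outerExpectation hC fun _ hU hUi hhU =>
    outerExpectation_le_integral hc hU hUi fun ω => (hgh ω).trans (hhU ω)

lemma outerExpectation_nonneg {g : Ω → ℝ} {C : ℝ} (hg : ∀ ω, 0 ≤ g ω) (hC : ∀ ω, g ω ≤ C) :
    0 ≤ outerExpectation P g :=
  le_outerExpectation hC fun _ _ _ hgU => integral_nonneg fun ω => (hg ω).trans (hgU ω)

lemma outerExpectation_add_le {g h : Ω → ℝ} {c c' C C' : ℝ} (hg : ∀ ω, c ≤ g ω)
    (hg' : ∀ ω, g ω ≤ C) (hh : ∀ ω, c' ≤ h ω) (hh' : ∀ ω, h ω ≤ C') :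
    outerExpectation P (fun ω => g ω + h ω) ≤ outerExpectation P g + outerExpectation P h := by
  rw [← sub_le_iff_le_add']
  refine le_outerExpectation hh' fun V hV hVi hhV => ?_
  rw [sub_le_comm]
  refine le_outerExpectation hg' fun U hU hUi hgU => ?_
  rw [sub_le_iff_le_add, ← integral_add hUi hVi]
  exact outerExpectation_le_integral (fun ω => add_le_add (hg ω) (hh ω)) (hU.add hV)
    (hUi.add hVi) fun ω => add_le_add (hgU ω) (hhV ω)

lemma outerExpectation_const_mul_le {g : Ω → ℝ} {C a : ℝ} (ha : 0 < a) (hg : ∀ ω, 0 ≤ g ω)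
    (hC : ∀ ω, g ω ≤ C) :
    outerExpectation P (fun ω => a * g ω) ≤ a * outerExpectation P g := by
  rw [← div_le_iff₀' ha]
  refine le_outerExpectation hC fun U hU hUi hgU => ?_
  rw [div_le_iff₀' ha, ← integral_const_mul]
  exact outerExpectation_le_integral (fun ω => mul_nonneg ha.le (hg ω)) (hU.const_mul a)
    (hUi.const_mul a) fun ω => mul_le_mul_of_nonneg_left (hgU ω) ha.le

/-- Inner expectation is at most outer expectation: subadditivity applied to `g + (-g) = 0`. -/
lemma neg_outerExpectation_neg_le {g : Ω → ℝ} {c C : ℝ} (hc : ∀ ω, c ≤ g ω)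
    (hC : ∀ ω, g ω ≤ C) : -outerExpectation P (fun ω => -g ω) ≤ outerExpectation P g := by
  have h := outerExpectation_add_le (P := P) hc hC (h := fun ω => -g ω)
    (fun ω => neg_le_neg (hC ω)) (fun ω => neg_le_neg (hc ω))
  have h0 : 0 ≤ outerExpectation P (fun ω => g ω + -g ω) :=
    outerExpectation_nonneg (C := 0) (by simp) (by simp)
  linarith

/-- Convergence to zero in (outer) probability implies convergence to zero of the truncated outer
expectations. -/
lemma tendsto_outerExpectation_min_one {d : ℕ → Ω → ℝ} (h0 : ∀ m ω, 0 ≤ d m ω)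
    (h : TendstoInMeasure P d atTop (fun _ => 0)) :
    Tendsto (fun m => outerExpectation P (fun ω => min 1 (d m ω))) atTop (𝓝 0) := by
  have hnn : ∀ m ω, 0 ≤ min 1 (d m ω) := fun m ω => le_min zero_le_one (h0 m ω)
  rw [tendsto_order]
  refine ⟨fun a ha => .of_forall fun m =>
    ha.trans_le (outerExpectation_nonneg (hnn m) fun ω => min_le_left _ _), fun ε hε => ?_⟩
  have h1 := h (ENNReal.ofReal (ε / 2)) (by simpa using hε)
  have h2 := (ENNReal.tendsto_toReal ENNReal.zero_ne_top).comp h1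
  filter_upwards [h2.eventually (gt_mem_nhds (show (0 : ℝ≥0∞).toReal < ε / 2 by simpa using hε))]
    with m hm
  set S := {x | ENNReal.ofReal (ε / 2) ≤ edist (d m x) 0}
  -- `S` may fail to be measurable; its measurable hull has the same measure, and the indicator of
  -- the hull plus `ε / 2` is an admissible majorant.
  have hS : MeasurableSet (toMeasurable P S) := measurableSet_toMeasurable P S
  have hi : Integrable ((toMeasurable P S).indicator fun _ => (1 : ℝ)) P :=
    (integrable_const 1).indicator hS
  have hle : outerExpectation P (fun ω => min 1 (d m ω)) ≤
      ∫ ω, ((toMeasurable P S).indicator (fun _ => (1 : ℝ)) ω + ε / 2) ∂P := by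
    refine outerExpectation_le_integral (hnn m) ?_ (hi.add (integrable_const _)) fun ω => ?_
    · exact (measurable_const.indicator hS).add_const _
    · by_cases hω : ω ∈ S
      · rw [Set.indicator_of_mem (subset_toMeasurable P S hω)]
        exact (min_le_left _ _).trans (by linarith)
      · have h3 : d m ω < ε / 2 := by
          have h4 : edist (d m ω) 0 < ENNReal.ofReal (ε / 2) := not_le.1 hω
          rw [edist_dist, Real.dist_0_eq_abs, abs_of_nonneg (h0 m ω)] at h4
          exact (ENNReal.ofReal_lt_ofReal_iff (by linarith)).1 h4
        have h5 : 0 ≤ (toMeasurable P S).indicator (fun _ => (1 : ℝ)) ω :=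
          Set.indicator_nonneg (by simp) ω
        exact (min_le_right _ _).trans (by linarith)
  rw [integral_add hi (integrable_const _), integral_indicator_const _ hS] at hle
  simp only [measureReal_def, measure_toMeasurable, smul_eq_mul, mul_one, integral_const,
    measure_univ, ENNReal.toReal_one, one_mul] at hle
  have : (P S).toReal < ε / 2 := hm
  linarith

end OuterExpectation

/-! ### Slutsky's lemma -/

section Slutsky

variable {S : Type*} [PseudoMetricSpace S]

/-- The sup-convolution `x ↦ sup_y (f y - k d(x, y))`. -/
def supConv (f : S →ᵇ ℝ) (k : ℕ) (x : S) : ℝ := ⨆ y, (f y - k * dist x y)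

lemma sub_mul_dist_le (f : S →ᵇ ℝ) (k : ℕ) (x y : S) : f y - k * dist x y ≤ ‖f‖ :=
  (sub_le_self _ (by positivity)).trans (f.apply_le_norm y)

lemma bddAbove_supConv (f : S →ᵇ ℝ) (k : ℕ) (x : S) :
    BddAbove (Set.range fun y => f y - k * dist x y) :=
  ⟨‖f‖, by rintro _ ⟨y, rfl⟩; exact sub_mul_dist_le f k x y⟩

lemma le_supConv (f : S →ᵇ ℝ) (k : ℕ) (x : S) : f x ≤ supConv f k x := by
  simpa [supConv] using le_ciSup (bddAbove_supConv f k x) x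

lemma supConv_le (f : S →ᵇ ℝ) (k : ℕ) (x : S) : supConv f k x ≤ ‖f‖ :=
  have : Nonempty S := ⟨x⟩
  ciSup_le (sub_mul_dist_le f k x)

lemma abs_supConv_le (f : S →ᵇ ℝ) (k : ℕ) (x : S) : |supConv f k x| ≤ ‖f‖ :=
  abs_le.2 ⟨(f.neg_norm_le_apply x).trans (le_supConv f k x), supConv_le f k x⟩

lemma supConv_le_add (f : S →ᵇ ℝ) (k : ℕ) (x y : S) :
    supConv f k x ≤ supConv f k y + k * dist x y := by
  have : Nonempty S := ⟨x⟩
  refine ciSup_le fun z => ?_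
  have h1 := le_ciSup (bddAbove_supConv f k y) z
  have h2 : (k : ℝ) * dist y z ≤ k * (dist x y + dist x z) := by
    gcongr
    rw [dist_comm x y]
    exact dist_triangle y x z
  simp only [supConv]
  linarith

lemma continuous_supConv (f : S →ᵇ ℝ) (k : ℕ) : Continuous (supConv f k) :=
  (LipschitzWith.of_le_add_mul (k : ℝ≥0) fun x y => by
    simpa using supConv_le_add f k x y).continuous

lemma tendsto_supConv (f : S →ᵇ ℝ) (x : S) :
    Tendsto (fun k => supConv f k x) atTop (𝓝 (f x)) := by
  have : Nonempty S := ⟨x⟩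
  rw [tendsto_order]
  refine ⟨fun a ha => .of_forall fun k => ha.trans_le (le_supConv f k x), fun a ha => ?_⟩
  obtain ⟨b, hb, hba⟩ := exists_between ha
  obtain ⟨δ, hδ, hball⟩ := Metric.mem_nhds_iff.1 (f.continuous.continuousAt (gt_mem_nhds hb))
  -- For such `k`, the penalty at distance at least `δ` outweighs the whole oscillation `2 * ‖f‖`,
  -- so only points near `x` matter.
  filter_upwards [eventually_ge_atTop ⌈2 * ‖f‖ / δ⌉₊] with k hk
  refine (ciSup_le fun y => ?_).trans_lt hba
  rcases lt_or_ge (dist y x) δ with hy | hy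
  · have h1 : f y < b := hball hy
    have h2 : 0 ≤ (k : ℝ) * dist x y := by positivity
    linarith
  · have h1 : 2 * ‖f‖ ≤ k * dist x y := by
      calc 2 * ‖f‖ = 2 * ‖f‖ / δ * δ := by field_simp
        _ ≤ k * dist x y := by
          rw [dist_comm] at hy
          gcongr
          exact (Nat.le_ceil _).trans (by exact_mod_cast hk)
    have h2 := f.apply_le_norm y
    have h3 := f.neg_norm_le_apply x
    linarith

/-- The sup-convolution as a bounded continuous function. -/
def supConvBCF (f : S →ᵇ ℝ) (k : ℕ) : S →ᵇ ℝ :=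
  .ofNormedAddCommGroup (supConv f k) (continuous_supConv f k) ‖f‖ (abs_supConv_le f k)

variable [MeasurableSpace S] [BorelSpace S]
  {Ω Ω' : Type*} [MeasurableSpace Ω] [MeasurableSpace Ω']
  {P : Measure Ω} [IsProbabilityMeasure P] {Q : Measure Ω'} [IsProbabilityMeasure Q]

/-- The upper half of Slutsky. Choose `k` so that the sup-convolution of `f` still has limit
integral below `a`; being Lipschitz and above `f`, it bounds `f (Y m)` by its value at `X m` plus a
multiple of the truncated distance. -/
lemma eventually_outerExpectation_lt {X Y : ℕ → Ω → S} {Z : Ω' → S} (hZ : AEMeasurable Z Q)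
    (hX : ∀ f : S →ᵇ ℝ,
      Tendsto (fun m => outerExpectation P fun ω => f (X m ω)) atTop (𝓝 (∫ ω, f (Z ω) ∂Q)))
    (hd : Tendsto (fun m => outerExpectation P fun ω => min 1 (dist (Y m ω) (X m ω)))
      atTop (𝓝 0)) (f : S →ᵇ ℝ) {a : ℝ} (ha : ∫ ω, f (Z ω) ∂Q < a) :
    ∀ᶠ m in atTop, outerExpectation P (fun ω => f (Y m ω)) < a := by
  have hlim : Tendsto (fun k => ∫ ω, supConv f k (Z ω) ∂Q) atTop (𝓝 (∫ ω, f (Z ω) ∂Q)) := by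
    refine tendsto_integral_of_dominated_convergence (fun _ => ‖f‖) (fun k => ?_)
      (integrable_const _) (fun k => .of_forall fun ω => abs_supConv_le f k _)
      (.of_forall fun ω => tendsto_supConv f _)
    exact ((continuous_supConv f k).measurable.comp_aemeasurable hZ).aestronglyMeasurable
  obtain ⟨k, hk⟩ := (hlim.eventually (gt_mem_nhds ha)).exists
  -- The Lipschitz constant `k` serves distances below `1`, the oscillation `2 * ‖f‖` serves the
  -- others, and `1` makes the factor positive.
  have hK : 0 < (k : ℝ) + 2 * ‖f‖ + 1 := by positivity
  have h := (hX (supConvBCF f k)).add (hd.const_mul ((k : ℝ) + 2 * ‖f‖ + 1))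
  rw [mul_zero, add_zero] at h
  filter_upwards [h.eventually (gt_mem_nhds hk)] with m hm
  refine lt_of_le_of_lt ?_ hm
  have hmin : ∀ ω, 0 ≤ min 1 (dist (Y m ω) (X m ω)) := fun ω => le_min zero_le_one dist_nonneg
  have hmin' : ∀ ω, min 1 (dist (Y m ω) (X m ω)) ≤ 1 := fun ω => min_le_left _ _
  have hs := fun ω => abs_le.1 (abs_supConv_le f k (X m ω))
  have hKm : ∀ ω, ((k : ℝ) + 2 * ‖f‖ + 1) * min 1 (dist (Y m ω) (X m ω)) ≤
      (k : ℝ) + 2 * ‖f‖ + 1 := fun ω => mul_le_of_le_one_right hK.le (hmin' ω)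
  calc outerExpectation P (fun ω => f (Y m ω))
      ≤ outerExpectation P (fun ω => supConv f k (X m ω) +
          ((k : ℝ) + 2 * ‖f‖ + 1) * min 1 (dist (Y m ω) (X m ω))) := by
        refine outerExpectation_mono (fun ω => f.neg_norm_le_apply _)
          (fun ω => add_le_add (hs ω).2 (hKm ω)) fun ω => ?_
        have h1 := supConv_le_add f k (Y m ω) (X m ω)
        have h2 := le_supConv f k (Y m ω)
        rcases le_total (dist (Y m ω) (X m ω)) 1 with h3 | h3
        · rw [min_eq_right h3]
          have : 0 ≤ (2 * ‖f‖ + 1) * dist (Y m ω) (X m ω) := by positivity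
          linarith
        · rw [min_eq_left h3]
          have h4 := f.apply_le_norm (Y m ω)
          have h5 : (0 : ℝ) ≤ k := k.cast_nonneg
          linarith [(hs ω).1]
    _ ≤ outerExpectation P (fun ω => supConv f k (X m ω)) + outerExpectation P
          (fun ω => ((k : ℝ) + 2 * ‖f‖ + 1) * min 1 (dist (Y m ω) (X m ω))) :=
        outerExpectation_add_le (fun ω => (hs ω).1) (fun ω => (hs ω).2)
          (fun ω => mul_nonneg hK.le (hmin ω)) hKm
    _ ≤ _ := by
        gcongr
        · rfl
        · exact outerExpectation_const_mul_le hK hmin hmin'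

/-- Slutsky's lemma for weak convergence in the sense of Hoffmann-Jørgensen. -/
theorem tendsto_outerExpectation_of_dist {X Y : ℕ → Ω → S} {Z : Ω' → S} (hZ : AEMeasurable Z Q)
    (hX : ∀ f : S →ᵇ ℝ,
      Tendsto (fun m => outerExpectation P fun ω => f (X m ω)) atTop (𝓝 (∫ ω, f (Z ω) ∂Q)))
    (hd : Tendsto (fun m => outerExpectation P fun ω => min 1 (dist (Y m ω) (X m ω)))
      atTop (𝓝 0)) (f : S →ᵇ ℝ) :
    Tendsto (fun m => outerExpectation P fun ω => f (Y m ω)) atTop (𝓝 (∫ ω, f (Z ω) ∂Q)) := by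
  rw [tendsto_order]
  refine ⟨fun a ha => ?_, fun a ha => eventually_outerExpectation_lt hZ hX hd f ha⟩
  -- The lower half is the upper half for `-f`, transferred back by inner ≤ outer.
  have h : ∫ ω, (-f) (Z ω) ∂Q < -a := by
    simpa only [BoundedContinuousFunction.coe_neg, Pi.neg_apply, integral_neg, neg_lt_neg_iff]
  filter_upwards [eventually_outerExpectation_lt hZ hX hd (-f) h] with m hm
  have := neg_outerExpectation_neg_le (P := P) (fun ω => f.neg_norm_le_apply (Y m ω))
    (fun ω => f.apply_le_norm (Y m ω))
  simp only [BoundedContinuousFunction.coe_neg, Pi.neg_apply] at hm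
  linarith

/-- A weakly convergent sequence is bounded in outer probability. -/
lemma tendsto_outerExpectation_norm_div {E : Type*} [NormedAddCommGroup E] [MeasurableSpace E]
    [BorelSpace E] {X : ℕ → Ω → E} {Z : Ω' → E} (hZ : AEMeasurable Z Q)
    (hX : ∀ f : E →ᵇ ℝ,
      Tendsto (fun m => outerExpectation P fun ω => f (X m ω)) atTop (𝓝 (∫ ω, f (Z ω) ∂Q))) :
    Tendsto (fun m : ℕ => outerExpectation P fun ω => min 1 (‖X m ω‖ / m)) atTop (𝓝 0) := by
  have hnn : ∀ (k : ℕ) (x : E), 0 ≤ min 1 (‖x‖ / k) := fun k x => le_min zero_le_one (by positivity)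
  have hle : ∀ (k : ℕ) (x : E), min 1 (‖x‖ / k) ≤ 1 := fun k x => min_le_left _ _
  have hcont : ∀ k : ℕ, Continuous fun x : E => min 1 (‖x‖ / k) := fun k => by fun_prop
  have hlim : Tendsto (fun k : ℕ => ∫ ω, min 1 (‖Z ω‖ / k) ∂Q) atTop (𝓝 0) := by
    rw [← integral_zero Ω' ℝ (μ := Q)]
    refine tendsto_integral_of_dominated_convergence (fun _ => 1) (fun k => ?_)
      (integrable_const _) (fun k => .of_forall fun ω => ?_) (.of_forall fun ω => ?_)
    · exact ((hcont k).measurable.comp_aemeasurable hZ).aestronglyMeasurable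
    · rw [Real.norm_of_nonneg (hnn _ _)]
      exact hle _ _
    · simpa using (tendsto_const_nhds (x := (1 : ℝ))).min
        (tendsto_const_nhds.div_atTop (tendsto_natCast_atTop_atTop (R := ℝ)) (a := ‖Z ω‖))
  rw [tendsto_order]
  refine ⟨fun a ha => .of_forall fun m => ha.trans_le (outerExpectation_nonneg
    (fun ω => hnn m _) fun ω => hle m _), fun a ha => ?_⟩
  -- Freezing the divisor at `k` gives one fixed bounded continuous test function, which dominates
  -- the expression for all `m ≥ k`.
  obtain ⟨k, hk, hk0⟩ := ((hlim.eventually (gt_mem_nhds ha)).and (eventually_gt_atTop 0)).exists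
  let f : E →ᵇ ℝ := .ofNormedAddCommGroup (fun x => min 1 (‖x‖ / k)) (hcont k) 1 fun x => by
    rw [Real.norm_of_nonneg (hnn _ _)]
    exact hle _ _
  filter_upwards [(hX f).eventually (gt_mem_nhds hk), eventually_ge_atTop k] with m hm hkm
  refine lt_of_le_of_lt ?_ hm
  refine outerExpectation_mono (fun ω => hnn m _) (fun ω => hle k _) fun ω => ?_
  refine min_le_min le_rfl ?_
  gcongr

end Slutsky


/-! ### Bounded functions -/

lemma toBddFun_of_memℓp {D E : Type*} [NormedAddCommGroup E] {g : D → E} (h : Memℓp g ∞) :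
    toBddFun g = ⟨g, h⟩ :=
  dif_pos h

lemma toBddFun_apply {D E : Type*} [NormedAddCommGroup E] {g : D → E} (h : Memℓp g ∞) (x : D) :
    toBddFun g x = g x := by
  rw [toBddFun_of_memℓp h]

lemma memℓp_infty_of_finite_range {D E : Type*} [NormedAddCommGroup E] {g : D → E}
    (h : (Set.range g).Finite) : Memℓp g ∞ := by
  refine memℓp_infty ((h.image norm).bddAbove.mono ?_)
  rintro _ ⟨x, rfl⟩
  exact ⟨g x, ⟨x, rfl⟩, rfl⟩

/-! ### The contrast functional -/

section Contrast

variable {E : Type*} [NormedAddCommGroup E] [NormedSpace ℝ E] {T : ℝ}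

/-- The first coordinate of a point of the pyramid. -/
def Delta3.fst (q : Delta3 T) : Set.Icc (0 : ℝ) (T + 1) :=
  ⟨q.1.1, q.2.1, q.2.2.1.trans (q.2.2.2.1.trans q.2.2.2.2)⟩

/-- The second coordinate of a point of the pyramid. -/
def Delta3.snd (q : Delta3 T) : Set.Icc (0 : ℝ) (T + 1) :=
  ⟨q.1.2.1, q.2.1.trans q.2.2.1, q.2.2.2.1.trans q.2.2.2.2⟩

/-- The third coordinate of a point of the pyramid. -/
def Delta3.trd (q : Delta3 T) : Set.Icc (0 : ℝ) (T + 1) :=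
  ⟨q.1.2.2, q.2.1.trans (q.2.2.1.trans q.2.2.2.1), q.2.2.2.2⟩

/-- The contrast `(t - s) (A s - A r) - (s - r) (A t - A s)`. -/
def contrast (A : Set.Icc (0 : ℝ) (T + 1) → E) (q : Delta3 T) : E :=
  (q.1.2.2 - q.1.2.1) • (A (Delta3.snd q) - A (Delta3.fst q)) -
    (q.1.2.1 - q.1.1) • (A (Delta3.trd q) - A (Delta3.snd q))

/-- Used with `K = T + 1` to bound the contrast and with `K = 1/m` to bound the rounding error of
the weights. -/
lemma norm_smul_sub_smul_le {a b K M : ℝ} {x y z : E} (ha : |a| ≤ K) (hb : |b| ≤ K)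
    (hx : ‖x‖ ≤ M) (hy : ‖y‖ ≤ M) (hz : ‖z‖ ≤ M) :
    ‖a • (y - x) - b • (z - y)‖ ≤ 4 * K * M := by
  have hK := (abs_nonneg a).trans ha
  calc ‖a • (y - x) - b • (z - y)‖ ≤ ‖a • (y - x)‖ + ‖b • (z - y)‖ := norm_sub_le _ _
    _ = |a| * ‖y - x‖ + |b| * ‖z - y‖ := by rw [norm_smul, norm_smul]; rfl
    _ ≤ K * (M + M) + K * (M + M) := by
      gcongr
      · exact (norm_sub_le _ _).trans (add_le_add hy hx)
      · exact (norm_sub_le _ _).trans (add_le_add hz hy)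
    _ = 4 * K * M := by ring

lemma norm_contrast_le {A : Set.Icc (0 : ℝ) (T + 1) → E} {M : ℝ} (hA : ∀ s, ‖A s‖ ≤ M)
    (q : Delta3 T) : ‖contrast A q‖ ≤ 4 * (T + 1) * M := by
  obtain ⟨h1, h2, h3, h4⟩ := q.2
  refine norm_smul_sub_smul_le ?_ ?_ (hA _) (hA _) (hA _)
  · rw [abs_of_nonneg] <;> linarith
  · rw [abs_of_nonneg] <;> linarith

lemma memℓp_contrast {A : Set.Icc (0 : ℝ) (T + 1) → E} (hA : Memℓp A ∞) :
    Memℓp (contrast A) ∞ := by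
  rw [memℓp_infty_iff] at hA ⊢
  obtain ⟨M, hM⟩ := hA
  exact ⟨4 * (T + 1) * M, by
    rintro _ ⟨q, rfl⟩; exact norm_contrast_le (fun s => hM ⟨s, rfl⟩) q⟩

lemma contrast_sub (A B : Set.Icc (0 : ℝ) (T + 1) → E) (q : Delta3 T) :
    contrast (A - B) q = contrast A q - contrast B q := by
  simp only [contrast, Pi.sub_apply]
  module

/-- The contrast as a map between spaces of bounded functions. -/
def contrastBdd (A : BddFun (Set.Icc (0 : ℝ) (T + 1)) E) : BddFun (Delta3 T) E :=
  ⟨contrast A, memℓp_contrast A.2⟩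

lemma toBddFun_contrast {A : Set.Icc (0 : ℝ) (T + 1) → E} (hA : Memℓp A ∞) :
    toBddFun (contrast A) = contrastBdd (toBddFun A) := by
  rw [toBddFun_of_memℓp hA, toBddFun_of_memℓp (memℓp_contrast hA)]
  rfl

lemma continuous_contrastBdd (hT : 0 ≤ T) :
    Continuous (contrastBdd : BddFun (Set.Icc (0 : ℝ) (T + 1)) E → BddFun (Delta3 T) E) := by
  refine (LipschitzWith.of_dist_le_mul (K := (4 * (T + 1)).toNNReal) fun A B => ?_).continuous
  rw [Real.coe_toNNReal _ (by positivity), dist_eq_norm, dist_eq_norm]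
  refine lp.norm_le_of_forall_le (by positivity) fun q => ?_
  have h := norm_contrast_le (fun s => lp.norm_apply_le_norm ENNReal.top_ne_zero (A - B) s) q
  rwa [lp.coeFn_sub, contrast_sub] at h

end Contrast

/-! ### Expansion of the monitoring process -/

section Expansion

lemma abs_floor_sub_floor_sub_le {x y : ℝ} (hx : 0 ≤ x) (hy : 0 ≤ y) :
    |((⌊y⌋₊ : ℝ) - ⌊x⌋₊) - (y - x)| ≤ 1 := by
  have h1 := Nat.floor_le hx
  have h2 := Nat.floor_le hy
  have h3 := (Nat.lt_floor_add_one x).le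
  have h4 := (Nat.lt_floor_add_one y).le
  exact abs_le.2 ⟨by linarith, by linarith⟩

lemma sum_Icc_succ_eq_sub {E : Type*} [AddCommGroup E] (g : ℕ → E) {l z : ℕ} (h : l ≤ z) :
    ∑ t ∈ Finset.Icc (l + 1) z, g t = ∑ t ∈ Finset.Icc 1 z, g t - ∑ t ∈ Finset.Icc 1 l, g t := by
  rw [eq_sub_iff_add_eq']
  induction z, h using Nat.le_induction with
  | base => simp
  | succ n hn ih =>
    rw [Finset.sum_Icc_succ_top (by omega), Finset.sum_Icc_succ_top (by omega), ← add_assoc, ih]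

/-- The rescaled monitoring process. -/
def monitorPath {d p : ℕ} {Ω : Type*} (X : ℤ → Ω → Fin d → ℝ)
    (θ : ((Fin d → ℝ) → ℝ) → EuclideanSpace ℝ (Fin p)) (T : ℝ) (m : ℕ) (ω : Ω)
    (q : Delta3 T) : EuclideanSpace ℝ (Fin p) :=
  ((m : ℝ) ^ (-(3 / 2) : ℝ)) • UTilde X θ
    ⌊(m : ℝ) * q.1.1⌋₊ ⌊(m : ℝ) * q.1.2.1⌋₊ ⌊(m : ℝ) * q.1.2.2⌋₊ ω

lemma finite_range_floor (T : ℝ) (m : ℕ) :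
    (Set.range fun s : Set.Icc (0 : ℝ) (T + 1) => ⌊(m : ℝ) * s⌋₊).Finite := by
  refine (Set.finite_Iic ⌊(m : ℝ) * (T + 1)⌋₊).subset ?_
  rintro _ ⟨s, rfl⟩
  exact Nat.floor_le_floor (mul_le_mul_of_nonneg_left s.2.2 m.cast_nonneg)

lemma memℓp_monitorPath {d p : ℕ} {Ω : Type*} (X : ℤ → Ω → Fin d → ℝ)
    (θ : ((Fin d → ℝ) → ℝ) → EuclideanSpace ℝ (Fin p)) (T : ℝ) (m : ℕ) (ω : Ω) :
    Memℓp (monitorPath X θ T m ω) ∞ := by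
  have hf := finite_range_floor T m
  refine memℓp_infty_of_finite_range (((hf.prod (hf.prod hf)).image
    fun n => ((m : ℝ) ^ (-(3 / 2) : ℝ)) • UTilde X θ n.1 n.2.1 n.2.2 ω).subset ?_)
  rintro _ ⟨q, rfl⟩
  exact ⟨(_, _, _), ⟨⟨Delta3.fst q, rfl⟩, ⟨Delta3.snd q, rfl⟩, ⟨Delta3.trd q, rfl⟩⟩, rfl⟩

variable {d p : ℕ} {Ω : Type*} [MeasurableSpace Ω] (P : Measure Ω)
  (X : ℤ → Ω → Fin d → ℝ) (θ : ((Fin d → ℝ) → ℝ) → EuclideanSpace ℝ (Fin p))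

/-- The partial sums of the influence function. -/
def influenceSum (n : ℕ) (ω : Ω) : EuclideanSpace ℝ (Fin p) :=
  ∑ t ∈ Finset.Icc 1 n, influence θ (distFun P (X 1)) (X t ω)

/-- The partial sum process of the influence function. -/
def influencePath (T : ℝ) (m : ℕ) (ω : Ω) (s : Set.Icc (0 : ℝ) (T + 1)) :
    EuclideanSpace ℝ (Fin p) :=
  (√(m : ℝ))⁻¹ • influenceSum P X θ ⌊(m : ℝ) * s⌋₊ ω

/-- Multiplying by the block length clears the denominator of the average. For an empty block the
weight is zero, so the default value of the estimator is harmless. -/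
lemma smul_estimator {l z : ℕ} (h : l ≤ z) (ω : Ω) :
    ((z : ℝ) - l) • estimator X θ (l + 1) z ω =
      ((z : ℝ) - l) • θ (distFun P (X 1)) + (influenceSum P X θ z ω - influenceSum P X θ l ω) +
        ((z : ℝ) - l) • remainder P X θ (l + 1) z ω := by
  rcases h.eq_or_lt with rfl | h
  · simp
  · have h0 : (z : ℝ) - l ≠ 0 := sub_ne_zero.2 (by exact_mod_cast h.ne')
    have h1 : (z : ℝ) - ((l + 1 : ℕ) : ℝ) + 1 = z - l := by push_cast; ring
    rw [remainder, h1, smul_sub, smul_sub, smul_inv_smul₀ h0, influenceSum, influenceSum,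
      sum_Icc_succ_eq_sub (fun t : ℕ => influence θ (distFun P (X 1)) (X t ω)) h.le]
    abel

lemma UTilde_eq {l z u : ℕ} (hlz : l ≤ z) (hzu : z ≤ u) (ω : Ω) :
    UTilde X θ l z u ω =
      (((u : ℝ) - z) • (influenceSum P X θ z ω - influenceSum P X θ l ω) -
        ((z : ℝ) - l) • (influenceSum P X θ u ω - influenceSum P X θ z ω)) +
      (((u : ℝ) - z) • ((z : ℝ) - l) • remainder P X θ (l + 1) z ω -
        ((z : ℝ) - l) • ((u : ℝ) - z) • remainder P X θ (z + 1) u ω) := by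
  have h1 := smul_estimator P X θ hlz ω
  have h2 := smul_estimator P X θ hzu ω
  have h3 : UTilde X θ l z u ω = ((u : ℝ) - z) • ((z : ℝ) - l) • estimator X θ (l + 1) z ω -
      ((z : ℝ) - l) • ((u : ℝ) - z) • estimator X θ (z + 1) u ω := by
    rw [UTilde]
    module
  rw [h3, h1, h2]
  module

lemma norm_smul_remainder_le {l z n : ℕ} (hlz : l ≤ z) (hzn : z ≤ n) (ω : Ω) :
    ‖((z : ℝ) - l) • remainder P X θ (l + 1) z ω‖ ≤ maxRemainder P X θ n ω := by
  rcases hlz.eq_or_lt with rfl | h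
  · simp
  · have h1 : ((z - (l + 1) + 1 : ℕ) : ℝ≥0) * ‖remainder P X θ (l + 1) z ω‖₊ ≤
        maxRemainder P X θ n ω :=
      (Finset.le_sup (f := fun i => ((z - i + 1 : ℕ) : ℝ≥0) * ‖remainder P X θ i z ω‖₊)
        (Finset.mem_Icc.2 ⟨by omega, h⟩)).trans
      (Finset.le_sup (f := fun j => (Finset.Icc 1 j).sup fun i =>
        ((j - i + 1 : ℕ) : ℝ≥0) * ‖remainder P X θ i j ω‖₊) (Finset.mem_Icc.2 ⟨by omega, hzn⟩))
    have h2 : z - (l + 1) + 1 = z - l := by omega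
    rw [h2, ← NNReal.coe_le_coe, NNReal.coe_mul, NNReal.coe_natCast, coe_nnnorm,
      Nat.cast_sub h.le] at h1
    rwa [norm_smul, Real.norm_of_nonneg (sub_nonneg.2 (by exact_mod_cast h.le))]

lemma memℓp_influencePath (T : ℝ) (m : ℕ) (ω : Ω) :
    Memℓp (influencePath P X θ T m ω) ∞ := by
  refine memℓp_infty_of_finite_range (((finite_range_floor T m).image
    fun n => (√(m : ℝ))⁻¹ • influenceSum P X θ n ω).subset ?_)
  rintro _ ⟨s, rfl⟩
  exact ⟨_, ⟨s, rfl⟩, rfl⟩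

variable {T : ℝ}

lemma norm_monitorPath_sub_contrast_le (hT : 0 ≤ T) {m : ℕ} (hm : 1 ≤ m) {ω : Ω} {M : ℝ}
    (hM : ∀ s, ‖influencePath P X θ T m ω s‖ ≤ M) (q : Delta3 T) :
    ‖monitorPath X θ T m ω q - contrast (influencePath P X θ T m ω) q‖ ≤
      4 * (M / m) + 2 * (T + 1) ^ 2 * ((maxRemainder P X θ ⌊(m : ℝ) * (T + 1)⌋₊ ω : ℝ) /
        √(⌊(m : ℝ) * (T + 1)⌋₊ : ℝ)) := by
  obtain ⟨h0r, hrs, hst, htT⟩ := q.2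
  set R := NNReal.toReal (maxRemainder P X θ ⌊(m : ℝ) * (T + 1)⌋₊ ω) with hR
  set n := ⌊(m : ℝ) * (T + 1)⌋₊ with hn
  set l := ⌊(m : ℝ) * q.1.1⌋₊ with hl
  set z := ⌊(m : ℝ) * q.1.2.1⌋₊ with hz
  set u := ⌊(m : ℝ) * q.1.2.2⌋₊ with hu
  have hR0 : 0 ≤ R := NNReal.coe_nonneg _
  have hm0 : (0 : ℝ) < m := by exact_mod_cast hm
  have hsm : (0 : ℝ) < √m := Real.sqrt_pos.2 hm0
  have hlz : l ≤ z := Nat.floor_le_floor (by gcongr)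
  have hzu : z ≤ u := Nat.floor_le_floor (by gcongr)
  have hun : u ≤ n := Nat.floor_le_floor (by gcongr)
  have hnm : (n : ℝ) ≤ m * (T + 1) := Nat.floor_le (by positivity)
  have hn1 : 0 < n := Nat.floor_pos.2 (by nlinarith [(by exact_mod_cast hm : (1 : ℝ) ≤ m)])
  have hsn : (0 : ℝ) < √n := Real.sqrt_pos.2 (by exact_mod_cast hn1)
  have hlz' : (l : ℝ) ≤ z := by exact_mod_cast hlz
  have hzu' : (z : ℝ) ≤ u := by exact_mod_cast hzu
  have hun' : (u : ℝ) ≤ n := by exact_mod_cast hun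
  have hpow : (m : ℝ) ^ (-(3 / 2) : ℝ) = (m : ℝ)⁻¹ * (√m)⁻¹ := by
    rw [show (-(3 / 2) : ℝ) = -1 + -(1 / 2) by norm_num, Real.rpow_add hm0, Real.rpow_neg_one,
      Real.rpow_neg hm0.le, ← Real.sqrt_eq_rpow]
  -- In each term the inner weight is the block length, absorbed by `maxRemainder`; the outer one is
  -- at most `n`.
  set D : EuclideanSpace ℝ (Fin p) :=
    ((u : ℝ) - z) • ((z : ℝ) - l) • remainder P X θ (l + 1) z ω -
      ((z : ℝ) - l) • ((u : ℝ) - z) • remainder P X θ (z + 1) u ω with hD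
  have hDle : ‖D‖ ≤ 2 * n * R := by
    have h1 : ∀ {a : ℝ} {v : EuclideanSpace ℝ (Fin p)}, 0 ≤ a → a ≤ n → ‖v‖ ≤ R →
        ‖a • v‖ ≤ n * R := fun ha han hv => by
      rw [norm_smul, Real.norm_of_nonneg ha]
      gcongr
    have h2 : (0 : ℝ) ≤ l := l.cast_nonneg
    have h3 : (0 : ℝ) ≤ z := z.cast_nonneg
    calc ‖D‖ ≤ ‖((u : ℝ) - z) • ((z : ℝ) - l) • remainder P X θ (l + 1) z ω‖ +
          ‖((z : ℝ) - l) • ((u : ℝ) - z) • remainder P X θ (z + 1) u ω‖ := norm_sub_le _ _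
      _ ≤ n * R + n * R := add_le_add
        (h1 (by linarith) (by linarith) (norm_smul_remainder_le P X θ hlz (hzu.trans hun) ω))
        (h1 (by linarith) (by linarith) (norm_smul_remainder_le P X θ hzu hun ω))
      _ = 2 * n * R := by ring
  have hdecomp : monitorPath X θ T m ω q - contrast (influencePath P X θ T m ω) q =
      (((m : ℝ)⁻¹ * (u - z) - (q.1.2.2 - q.1.2.1)) •
        (influencePath P X θ T m ω (Delta3.snd q) -
          influencePath P X θ T m ω (Delta3.fst q)) -
      ((m : ℝ)⁻¹ * (z - l) - (q.1.2.1 - q.1.1)) •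
        (influencePath P X θ T m ω (Delta3.trd q) -
          influencePath P X θ T m ω (Delta3.snd q))) +
      ((m : ℝ)⁻¹ * (√m)⁻¹) • D := by
    rw [monitorPath, hpow, ← hl, ← hz, ← hu, UTilde_eq P X θ hlz hzu ω, ← hD]
    simp only [contrast, influencePath, Delta3.fst, Delta3.snd, Delta3.trd, ← hl, ← hz, ← hu]
    module
  have hfloor : ∀ {x y : ℝ}, 0 ≤ x → x ≤ y →
      |(m : ℝ)⁻¹ * (⌊(m : ℝ) * y⌋₊ - ⌊(m : ℝ) * x⌋₊) - (y - x)| ≤ (m : ℝ)⁻¹ := fun {x y} hx hxy => by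
    have h := abs_floor_sub_floor_sub_le (mul_nonneg hm0.le hx) (mul_nonneg hm0.le (hx.trans hxy))
    calc _ = |(m : ℝ)⁻¹ * ((⌊(m : ℝ) * y⌋₊ - ⌊(m : ℝ) * x⌋₊) - (m * y - m * x))| := by
          congr 1
          field_simp
      _ ≤ (m : ℝ)⁻¹ := by
          rw [abs_mul, abs_of_pos (inv_pos.2 hm0)]
          exact mul_le_of_le_one_right (by positivity) h
  rw [hdecomp]
  refine (norm_add_le _ _).trans (add_le_add ?_ ?_)
  · refine (norm_smul_sub_smul_le (hfloor (h0r.trans hrs) hst) (hfloor h0r hrs)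
      (hM _) (hM _) (hM _)).trans_eq ?_
    ring
  · rw [norm_smul, Real.norm_of_nonneg (by positivity)]
    -- The remainder hypothesis is normalized by `√n`, so `√m` is exchanged for it, using `√(T + 1)
    -- ≤ T + 1`.
    have h1 : (√m)⁻¹ ≤ (T + 1) * (√n)⁻¹ := by
      rw [← div_eq_mul_inv, le_div_iff₀ hsn, inv_mul_le_iff₀ hsm]
      calc √(n : ℝ) ≤ √(m * (T + 1)) := Real.sqrt_le_sqrt hnm
        _ = √m * √(T + 1) := Real.sqrt_mul hm0.le _
        _ ≤ √m * (T + 1) := by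
          gcongr
          exact Real.sqrt_le_iff.2 ⟨by linarith, by nlinarith⟩
    calc (m : ℝ)⁻¹ * (√m)⁻¹ * ‖D‖
        ≤ (m : ℝ)⁻¹ * ((T + 1) * (√n)⁻¹) * (2 * (m * (T + 1)) * R) := by
          gcongr
          exact hDle.trans (by gcongr)
      _ = 2 * (T + 1) ^ 2 * (R / √n) := by field_simp

end Expansion

end SeqMonitor

end

/-! ### Continuous mapping and Slutsky for the monitoring process -/

open SeqMonitor in
theorem mainTheorem1 {d p : ℕ} {Ω Ω' : Type*} [MeasurableSpace Ω] [MeasurableSpace Ω']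
    (P : Measure Ω) [IsProbabilityMeasure P] (Q : Measure Ω') [IsProbabilityMeasure Q]
    (X : ℤ → Ω → Fin d → ℝ) (hX : ∀ t, Measurable (X t))
    (θ : ((Fin d → ℝ) → ℝ) → EuclideanSpace ℝ (Fin p))
    (hIF : SeqMonitor.InfluenceExists θ (SeqMonitor.distFun P (X 1)))
    (T : ℝ) (hT : 0 ≤ T)
    (W : ℝ≥0 → Ω' → EuclideanSpace ℝ (Fin p)) (hW : SeqMonitor.IsStdBrownian W Q)
    (h_null : SeqMonitor.NullHypothesis P X θ)
    (h_inv : SeqMonitor.InvariancePrinciple P Q X θ T W)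
    (h_rem : SeqMonitor.RemainderNegligible P X θ) :
    SeqMonitor.WeakConvBddFun P Q
      (fun (m : ℕ) ω (q : SeqMonitor.Delta3 T) =>
        ((m : ℝ) ^ (-(3 / 2) : ℝ)) • SeqMonitor.UTilde X θ
          ⌊(m : ℝ) * q.1.1⌋₊ ⌊(m : ℝ) * q.1.2.1⌋₊ ⌊(m : ℝ) * q.1.2.2⌋₊ ω)
      (fun ω (q : SeqMonitor.Delta3 T) =>
        SeqMonitor.sqrtLongRunVar P X θ
          (SeqMonitor.bridge W q.1.2.1 q.1.2.2 ω + SeqMonitor.bridge W q.1.1 q.1.2.1 ω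
            - SeqMonitor.bridge W q.1.1 q.1.2.2 ω)) := by

  set Z : Ω' → Set.Icc (0 : ℝ) (T + 1) → EuclideanSpace ℝ (Fin p) :=
    fun ω s => sqrtLongRunVar P X θ (W (s : ℝ).toNNReal ω)
  have hlim : (fun ω (q : Delta3 T) => sqrtLongRunVar P X θ
      (bridge W q.1.2.1 q.1.2.2 ω + bridge W q.1.1 q.1.2.1 ω - bridge W q.1.1 q.1.2.2 ω)) =
      fun ω => contrast (Z ω) := by
    ext1 ω
    ext1 q
    simp only [bridge, contrast, Z, Delta3.fst, Delta3.snd, Delta3.trd, map_add, map_sub, map_smul]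
    module
  obtain ⟨-, hZb, hZm, hconv⟩ : WeakConvBddFun P Q (influencePath P X θ T) Z :=
    h_inv.weakConv
  change WeakConvBddFun P Q (monitorPath X θ T) _
  rw [hlim]
  have hΦ := continuous_contrastBdd (E := EuclideanSpace ℝ (Fin p)) hT
  -- Only almost sure: an unbounded path is sent to `0`, while its contrast might be bounded and
  -- nonzero.
  have hae : (fun ω => toBddFun (contrast (Z ω))) =ᵐ[Q] fun ω => contrastBdd (toBddFun (Z ω)) :=
    hZb.mono fun ω hω => toBddFun_contrast hω
  have hΦm : AEMeasurable (fun ω => contrastBdd (toBddFun (Z ω))) Q :=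
    hΦ.measurable.comp_aemeasurable hZm
  refine ⟨fun m => .of_forall fun ω => memℓp_monitorPath X θ T m ω,
    hZb.mono fun ω hω => memℓp_contrast hω, hΦm.congr hae.symm, fun f => ?_⟩
  rw [integral_congr_ae (hae.mono fun ω hω => congrArg f hω)]
  refine tendsto_outerExpectation_of_dist hΦm
    (X := fun m ω => contrastBdd (toBddFun (influencePath P X θ T m ω)))
    (fun g => hconv (g.compContinuous ⟨_, hΦ⟩)) ?_ f
  set n : ℕ → ℕ := fun m => ⌊(m : ℝ) * (T + 1)⌋₊
  have hn : Tendsto n atTop atTop :=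
    tendsto_nat_floor_atTop.comp
      (tendsto_natCast_atTop_atTop.atTop_mul_const (by linarith : (0 : ℝ) < T + 1))
  have h1 := tendsto_outerExpectation_norm_div hZm hconv
  have h2 := tendsto_outerExpectation_min_one (P := P)
    (d := fun m ω => (maxRemainder P X θ (n m) ω : ℝ) / √(n m : ℝ))
    (fun m ω => by positivity) fun ε hε => (h_rem ε hε).comp hn
  have hC : 0 < 2 * (T + 1) ^ 2 := by positivity
  have h3 := (h1.const_mul 4).add (h2.const_mul (2 * (T + 1) ^ 2))
  rw [mul_zero, mul_zero, add_zero] at h3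
  refine tendsto_of_tendsto_of_tendsto_of_le_of_le' tendsto_const_nhds h3
    (.of_forall fun m => outerExpectation_nonneg (fun ω => le_min zero_le_one dist_nonneg)
      fun ω => min_le_left _ _) ?_
  filter_upwards [eventually_ge_atTop 1] with m hm
  set a : Ω → ℝ := fun ω => ‖toBddFun (influencePath P X θ T m ω)‖ / m
  set b : Ω → ℝ := fun ω => (maxRemainder P X θ (n m) ω : ℝ) / √(n m : ℝ)
  have ha0 : ∀ ω, 0 ≤ a ω := fun ω => by positivity
  have hb0 : ∀ ω, 0 ≤ b ω := fun ω => by positivity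
  have ha : ∀ ω, 0 ≤ min 1 (a ω) := fun ω => le_min zero_le_one (ha0 ω)
  have hb : ∀ ω, 0 ≤ min 1 (b ω) := fun ω => le_min zero_le_one (hb0 ω)
  have ha' : ∀ ω, 4 * min 1 (a ω) ≤ 4 := fun ω =>
    mul_le_of_le_one_right (by norm_num) (min_le_left _ _)
  have hb' : ∀ ω, 2 * (T + 1) ^ 2 * min 1 (b ω) ≤ 2 * (T + 1) ^ 2 := fun ω =>
    mul_le_of_le_one_right hC.le (min_le_left _ _)
  have hdist : ∀ ω, dist (toBddFun (monitorPath X θ T m ω))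
      (contrastBdd (toBddFun (influencePath P X θ T m ω))) ≤
      4 * a ω + 2 * (T + 1) ^ 2 * b ω := fun ω => by
    have hA := memℓp_influencePath P X θ T m ω
    rw [dist_eq_norm, ← toBddFun_contrast hA]
    refine lp.norm_le_of_forall_le
      (add_nonneg (mul_nonneg zero_le_four (ha0 ω)) (mul_nonneg hC.le (hb0 ω))) fun q => ?_
    rw [lp.coeFn_sub, Pi.sub_apply, toBddFun_apply (memℓp_monitorPath X θ T m ω),
      toBddFun_apply (memℓp_contrast hA)]
    refine norm_monitorPath_sub_contrast_le P X θ hT hm (fun s => ?_) q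
    rw [← toBddFun_apply hA s]
    exact lp.norm_apply_le_norm ENNReal.top_ne_zero _ s
  calc _ ≤ outerExpectation P fun ω => 4 * min 1 (a ω) + 2 * (T + 1) ^ 2 * min 1 (b ω) := by
        refine outerExpectation_mono (fun ω => le_min zero_le_one dist_nonneg)
          (fun ω => add_le_add (ha' ω) (hb' ω)) fun ω => ?_
        -- Both coefficients are at least `1`, so once either truncation is active the right side
        -- already exceeds the bound `1` on the left.
        have hT2 : 1 ≤ 2 * (T + 1) ^ 2 := by nlinarith
        have hca := ha ω
        have hcb := hb ω
        rcases le_total 1 (a ω) with h4 | h4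
        · rw [min_eq_left h4]
          exact (min_le_left _ _).trans (by nlinarith)
        rcases le_total 1 (b ω) with h5 | h5
        · rw [min_eq_left h5]
          exact (min_le_left _ _).trans (by linarith)
        rw [min_eq_right h4, min_eq_right h5]
        exact (min_le_right _ _).trans (hdist ω)
    _ ≤ _ := outerExpectation_add_le (fun ω => mul_nonneg zero_le_four (ha ω)) ha'
        (fun ω => mul_nonneg hC.le (hb ω)) hb'
    _ ≤ _ := add_le_add
        (outerExpectation_const_mul_le zero_lt_four ha fun ω => min_le_left _ _)
        (outerExpectation_const_mul_le hC hb fun ω => min_le_left _ _)
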